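/- Let $R$ be a commutative ring with identity. An element $v$ of a free $R$-module $F$ is called unimodular if there is an $R$-linear map $L\colon F\to R$ with $L(v)=1$; this applies in particular to matrices in the free $R$-module $\mathbb M_2(R)$ of $2\times 2$ matrices over $R$. A unimodular matrix $A\in\mathbb M_2(R)$ is called determinant liftable if there is a unimodular matrix $B\in\mathbb M_2(R)$ with $\det(B)=0$ such that all entries of $B-A$ belong to the ideal $R\det(A)$. Let $A=\begin{pmatrix} a & b\\ c & d\end{pmatrix}\in\mathbb M_2(R)$ be unimodular. Then the following statements are equivalent. (1) The matrix $A$ is determinant liftable. (2) There exists a unimodular matrix $C\in\mathbb M_2(R)$ such that $A+\det(A)C$ is unimodular and $\det(C)=\det\bigl(A+\det(A)C\bigr)=0$. (3) There exists $(x,y,z,w)\in R^4$ such that $ax+by+cz+dw=1$ and $xw-yz=0$. (4) There exists $C\in\mathbb M_2(R)$ such that $\det(C)=\det\bigl(A+\det(A)C\bigr)=0$. -/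

import Mathlib

/-- An element `v` of an `R`-module `F` is unimodular if some `R`-linear map `L : F → R`
satisfies `L v = 1`. (The notion is used for free modules `F`.) -/
def IsUnimodularElem (R : Type*) [CommRing R] {F : Type*} [AddCommGroup F] [Module R F]
    (v : F) : Prop :=
  ∃ L : F →ₗ[R] R, L v = 1

/-- Two square matrices are congruent modulo an ideal `I` if all entries of their difference
belong to `I`. -/
def MatrixCongruentMod {R : Type*} [CommRing R] {n : ℕ} (I : Ideal R)
    (B C : Matrix (Fin n) (Fin n) R) : Prop :=
  ∀ i j, (B - C) i j ∈ I

/-- A unimodular `2 × 2` matrix `A` is determinant liftable if there is a unimodular `2 × 2`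
matrix `B`, congruent to `A` modulo the principal ideal generated by `det A`, with `det B = 0`. -/
def IsDeterminantLiftable {R : Type*} [CommRing R] (A : Matrix (Fin 2) (Fin 2) R) : Prop :=
  IsUnimodularElem R A ∧
    ∃ B : Matrix (Fin 2) (Fin 2) R, IsUnimodularElem R B ∧
      MatrixCongruentMod (Ideal.span {A.det}) B A ∧ B.det = 0

/-! Condition (3) asks for a singular `X` with `tr (A X) = 1`. By
`exists_det_eq_zero_trace_mul_eq_one` it is enough that `det A * det Y = 0` for some `Y` with `tr (A
Y) = 1`; (1) and (4) each supply such a `Y`. Conversely, `C = -adj X` gives (2), from which (1) and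
(4) are immediate. -/

open Matrix in
/-- A matrix is unimodular iff its trace pairing with some matrix equals `1`. -/
theorem isUnimodularElem_iff_exists_trace_mul {R : Type*} [CommRing R]
    (A : Matrix (Fin 2) (Fin 2) R) :
    IsUnimodularElem R A ↔ ∃ M : Matrix (Fin 2) (Fin 2) R, (A * M).trace = 1 := by
  constructor
  · rintro ⟨L, hL⟩
    refine ⟨!![L (single 0 0 1), L (single 1 0 1); L (single 0 1 1), L (single 1 1 1)], ?_⟩
    have hA : A = A 0 0 • single 0 0 1 + A 0 1 • single 0 1 1
        + A 1 0 • single 1 0 1 + A 1 1 • single 1 1 1 := by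
      ext i j
      fin_cases i <;> fin_cases j <;> simp [Matrix.single]
    rw [hA] at hL
    simp only [map_add, map_smul, smul_eq_mul] at hL
    simp only [trace_fin_two, mul_apply, Fin.sum_univ_two, of_apply, cons_val', cons_val_zero,
      cons_val_one, cons_val_fin_one]
    linear_combination hL
  · rintro ⟨M, hM⟩
    exact ⟨traceLinearMap (Fin 2) R R ∘ₗ LinearMap.mulRight R M, hM⟩

/-- If `tr (A Y) = 1` and `det A * det Y = 0`, then `Y A Y` is a singular matrix whose trace
pairing with `A` is still `1`. -/
theorem exists_det_eq_zero_trace_mul_eq_one {R : Type*} [CommRing R]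
    {A Y : Matrix (Fin 2) (Fin 2) R} (htr : (A * Y).trace = 1) (hdet : A.det * Y.det = 0) :
    ∃ X : Matrix (Fin 2) (Fin 2) R, (A * X).trace = 1 ∧ X.det = 0 := by
  refine ⟨Y * A * Y, ?_, ?_⟩
  · have h : (A * (Y * A * Y)).trace = (A * Y).trace ^ 2 - 2 * (A.det * Y.det) := by
      simp only [Matrix.trace_fin_two, Matrix.det_fin_two, Matrix.mul_apply, Fin.sum_univ_two]
      ring
    rw [h, htr, hdet]
    ring
  · rw [Matrix.det_mul, Matrix.det_mul]
    linear_combination Y.det * hdet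

theorem Matrix.det_add_smul_fin_two {R : Type*} [CommRing R] (A C : Matrix (Fin 2) (Fin 2) R)
    (r : R) :
    (A + r • C).det = A.det + r * (A * C.adjugate).trace + r ^ 2 * C.det := by
  simp only [Matrix.trace_fin_two, Matrix.det_fin_two, Matrix.mul_apply, Fin.sum_univ_two,
    Matrix.adjugate_fin_two, Matrix.add_apply, Matrix.smul_apply, smul_eq_mul, Matrix.of_apply,
    Matrix.cons_val', Matrix.cons_val_zero, Matrix.cons_val_one, Matrix.cons_val_fin_one]
  ring

theorem MatrixCongruentMod.exists_eq_add_smul {R : Type*} [CommRing R] {n : ℕ} {r : R}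
    {B A : Matrix (Fin n) (Fin n) R} (h : MatrixCongruentMod (Ideal.span {r}) B A) :
    ∃ C : Matrix (Fin n) (Fin n) R, B = A + r • C := by
  choose C hC using fun i j => Ideal.mem_span_singleton'.mp (h i j)
  refine ⟨Matrix.of C, ?_⟩
  ext i j
  have := hC i j
  simp only [Matrix.sub_apply] at this
  simp only [Matrix.add_apply, Matrix.smul_apply, Matrix.of_apply, smul_eq_mul]
  linear_combination -this

theorem matrixCongruentMod_add_smul {R : Type*} [CommRing R] {n : ℕ} (r : R)
    (A C : Matrix (Fin n) (Fin n) R) : MatrixCongruentMod (Ideal.span {r}) (A + r • C) A := by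
  intro i j
  rw [add_sub_cancel_left]
  exact Ideal.mul_mem_right _ _ (Ideal.mem_span_singleton_self r)

theorem IsDeterminantLiftable.exists_det_eq_zero_trace_mul_eq_one {R : Type*} [CommRing R]
    {A : Matrix (Fin 2) (Fin 2) R} (h : IsDeterminantLiftable A) :
    ∃ X : Matrix (Fin 2) (Fin 2) R, (A * X).trace = 1 ∧ X.det = 0 := by
  obtain ⟨-, B, hB, hBA, hdet⟩ := h
  obtain ⟨C, rfl⟩ := hBA.exists_eq_add_smul
  -- Since `det A = A * adj A`, the lift is a right multiple of `A`; the cofactor times `M` serves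
  -- as `Y`.
  have hfac : A + A.det • C = A * (1 + A.adjugate * C) := by
    rw [mul_add, mul_one, ← mul_assoc, Matrix.mul_adjugate, Matrix.smul_mul, one_mul]
  rw [hfac] at hB hdet
  obtain ⟨M, hM⟩ := (isUnimodularElem_iff_exists_trace_mul _).mp hB
  rw [mul_assoc] at hM
  refine _root_.exists_det_eq_zero_trace_mul_eq_one hM ?_
  rw [Matrix.det_mul] at hdet ⊢
  rw [← mul_assoc, hdet, zero_mul]

theorem exists_trace_mul_eq_one_of_det_add_smul_eq_zero {R : Type*} [CommRing R]
    {A C : Matrix (Fin 2) (Fin 2) R} (hU : IsUnimodularElem R A) (hC : C.det = 0)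
    (hAC : (A + A.det • C).det = 0) :
    ∃ X : Matrix (Fin 2) (Fin 2) R, (A * X).trace = 1 ∧ X.det = 0 := by
  obtain ⟨M, hM⟩ := (isUnimodularElem_iff_exists_trace_mul A).mp hU
  rw [Matrix.det_add_smul_fin_two, hC] at hAC
  set e : R := 1 + (A * C.adjugate).trace with he
  have hAe : A.det * e = 0 := by linear_combination hAC
  -- `tr (A * -adj C) = 1 - e`, so adding `e • M` corrects the trace to `1`; it changes the
  -- determinant only by a multiple of `e`, which `det A` kills.
  refine exists_det_eq_zero_trace_mul_eq_one (Y := -C.adjugate + e • M) ?_ ?_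
  · rw [mul_add, mul_neg, Matrix.mul_smul, Matrix.trace_add, Matrix.trace_neg, Matrix.trace_smul,
      hM, smul_eq_mul, he]
    ring
  · have hN : (-C.adjugate).det = 0 := by
      rw [Matrix.det_neg, Matrix.det_adjugate, hC]
      simp
    rw [Matrix.det_add_smul_fin_two, hN]
    linear_combination ((-C.adjugate * M.adjugate).trace + e * M.det) * hAe

/-- With `C = -adj X`, the determinant of the lift is `det A * (1 - tr (A X)) = 0`. As `adj X * X =
0`, the lift and `A` have the same product with `X`. -/
theorem exists_isUnimodularElem_add_smul_of_trace_mul_eq_one {R : Type*} [CommRing R]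
    {A X : Matrix (Fin 2) (Fin 2) R} (htr : (A * X).trace = 1) (hX : X.det = 0) :
    ∃ C : Matrix (Fin 2) (Fin 2) R, IsUnimodularElem R C ∧
      IsUnimodularElem R (A + A.det • C) ∧ C.det = 0 ∧ (A + A.det • C).det = 0 := by
  have hadj : (-X.adjugate).adjugate = -X := by
    ext i j
    fin_cases i <;> fin_cases j <;> simp [Matrix.adjugate_fin_two]
  have hdet : (-X.adjugate).det = 0 := by
    rw [Matrix.det_neg, Matrix.det_adjugate, hX]
    simp
  refine ⟨-X.adjugate, ?_, ?_, hdet, ?_⟩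
  · refine (isUnimodularElem_iff_exists_trace_mul _).mpr ⟨-A.adjugate, ?_⟩
    rw [neg_mul_neg, ← Matrix.adjugate_mul_distrib, ← htr]
    simp [Matrix.adjugate_fin_two, Matrix.trace_fin_two, add_comm]
  · refine (isUnimodularElem_iff_exists_trace_mul _).mpr ⟨X, ?_⟩
    rw [add_mul, Matrix.smul_mul, neg_mul, Matrix.adjugate_mul, hX]
    simp [htr]
  · rw [Matrix.det_add_smul_fin_two, hdet, hadj, mul_neg, Matrix.trace_neg, htr]
    ring

theorem exists_det_eq_zero_trace_mul_eq_one_iff {R : Type*} [CommRing R] (a b c d : R) :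
    (∃ X : Matrix (Fin 2) (Fin 2) R, (!![a, b; c, d] * X).trace = 1 ∧ X.det = 0) ↔
      ∃ x y z w : R, a * x + b * y + c * z + d * w = 1 ∧ x * w - y * z = 0 := by
  constructor
  · rintro ⟨X, htr, hX⟩
    -- The trace pairing matches entries of `A` with those of the transpose of `X`.
    refine ⟨X 0 0, X 1 0, X 0 1, X 1 1, ?_, ?_⟩
    · simp only [Matrix.trace_fin_two, Matrix.mul_apply, Fin.sum_univ_two, Matrix.of_apply,
        Matrix.cons_val', Matrix.cons_val_zero, Matrix.cons_val_one, Matrix.cons_val_fin_one] at htr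
      linear_combination htr
    · rw [Matrix.det_fin_two] at hX
      linear_combination hX
  · rintro ⟨x, y, z, w, h, hdet⟩
    refine ⟨!![x, z; y, w], ?_, ?_⟩
    · simp [Matrix.trace_fin_two]
      linear_combination h
    · rw [Matrix.det_fin_two_of]
      linear_combination hdet

theorem theorem1 {R : Type*} [CommRing R] (a b c d : R)
    (A : Matrix (Fin 2) (Fin 2) R) (hA : A = !![a, b; c, d]) (hU : IsUnimodularElem R A) :
    List.TFAE [
      IsDeterminantLiftable A,
      ∃ C : Matrix (Fin 2) (Fin 2) R, IsUnimodularElem R C ∧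
        IsUnimodularElem R (A + A.det • C) ∧ C.det = 0 ∧ (A + A.det • C).det = 0,
      ∃ x y z w : R, a * x + b * y + c * z + d * w = 1 ∧ x * w - y * z = 0,
      ∃ C : Matrix (Fin 2) (Fin 2) R, C.det = 0 ∧ (A + A.det • C).det = 0] := by
  rw [← exists_det_eq_zero_trace_mul_eq_one_iff, ← hA]
  tfae_have 1 → 3 := IsDeterminantLiftable.exists_det_eq_zero_trace_mul_eq_one
  tfae_have 3 → 2 := fun ⟨_, htr, hX⟩ =>
    exists_isUnimodularElem_add_smul_of_trace_mul_eq_one htr hX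
  tfae_have 2 → 1 := fun ⟨C, _, hB, _, hdet⟩ =>
    ⟨hU, A + A.det • C, hB, matrixCongruentMod_add_smul _ A C, hdet⟩
  tfae_have 2 → 4 := fun ⟨C, _, _, hC, hdet⟩ => ⟨C, hC, hdet⟩
  tfae_have 4 → 3 := fun ⟨_, hC, hdet⟩ =>
    exists_trace_mul_eq_one_of_det_add_smul_eq_zero hU hC hdet
  tfae_finish
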